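/- Let $q:[0,1]\to\mathbb R$ be continuous, let $\lambda_1<\lambda_2<\cdots$ be the list of all the eigenvalues of the Dirichlet problem $$-y''+q\,y=\lambda y \ \text{ in } ]0,1[,\qquad y(0)=y(1)=0,$$ and for each $j\ge 1$ let $h_j$ be a real eigenfunction ($h_j\in C^2([0,1])$, $h_j\not\equiv 0$) for the eigenvalue $\lambda_j$. For $n\ge 1$ let $$\mathfrak S_n(x_1,\dots,x_n)=\det\big(h_i(x_j)\big)_{1\le i,j\le n}$$ be the Slater determinant of the first $n$ eigenfunctions, and for $b\in\mathbb R^n$ let $S_b=\sum_{j=1}^n b_j h_j$. Then, for every $n\ge1$: 1. $\mathfrak S_n(x_1,\dots,x_n)\neq 0$ whenever $0<x_1<\cdots<x_n<1$. 2. Let $b\in\mathbb R^n\setminus\{0\}$ and assume that $S_b$ has at least $n-1$ zeros $c_1<c_2<\cdots<c_{n-1}$ in $]0,1[$. Then there exists a constant $C\neq 0$ such that $$S_b(x)=C\,\mathfrak S_n(c_1,\dots,c_{n-1},x)\qquad\text{for all } x\in[0,1],$$ and $c_1,\dots,c_{n-1}$ are the only zeros of $S_b$ in $]0,1[$. 3.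 For every $b\in\mathbb R^n\setminus\{0\}$ the function $S_b$ has at most $n-1$ zeros in $]0,1[$ (counted without multiplicity); hence it has at most $n$ nodal domains, i.e. $\{x\in\,]0,1[\,:\,S_b(x)\ne0\}$ has at most $n$ connected components. -/

import Mathlib

open Set

/-- `u` is a (classical, real-valued) eigenfunction, for the eigenvalue `μ`, of the Dirichlet
realization of `-d²/dx² + q` in `]0,1[`: `u` is `C²` on `[0,1]`, not identically zero,
`-u'' + q u = μ u` in `]0,1[`, and `u(0) = u(1) = 0`. -/
structure IsDirichletEigenfunction (q : ℝ → ℝ) (μ : ℝ) (u : ℝ → ℝ) : Prop where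
  contDiffOn : ContDiffOn ℝ 2 u (Icc 0 1)
  ne_zero : ∃ x ∈ Ioo (0 : ℝ) 1, u x ≠ 0
  eqn : ∀ x ∈ Ioo (0 : ℝ) 1, -deriv (deriv u) x + q x * u x = μ * u x
  left : u 0 = 0
  right : u 1 = 0

/-- The set of all Dirichlet eigenvalues of `-d²/dx² + q` in `]0,1[`. -/
def dirichletSpectrum (q : ℝ → ℝ) : Set ℝ :=
  {μ | ∃ u : ℝ → ℝ, IsDirichletEigenfunction q μ u}

/-- `(lam j, h j)`, `j = 0, 1, 2, …`, are the Dirichlet eigenpairs of `-d²/dx² + q` in `]0,1[`: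
`lam 0 < lam 1 < …` is the list of all the eigenvalues, and `h j` is an eigenfunction for the
eigenvalue `lam j`. (The indices start at `0`, so `h 0, …, h (n-1)` are the first `n`
eigenfunctions.) -/
structure IsDirichletEigenpairs (q : ℝ → ℝ) (lam : ℕ → ℝ) (h : ℕ → ℝ → ℝ) : Prop where
  strictMono : StrictMono lam
  range_eq : range lam = dirichletSpectrum q
  eigenfunction : ∀ j, IsDirichletEigenfunction q (lam j) (h j)

/-- The open simplex `{0 < x_1 < ⋯ < x_n < 1}`. -/
def openSimplex (n : ℕ) : Set (Fin n → ℝ) :=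
  {x | StrictMono x ∧ ∀ i, x i ∈ Ioo (0 : ℝ) 1}

/-- The Slater determinant `𝔖_n(x_1, …, x_n) = det (h_i(x_j))` of the first `n` functions. -/
noncomputable def slater (h : ℕ → ℝ → ℝ) {n : ℕ} (x : Fin n → ℝ) : ℝ :=
  Matrix.det (Matrix.of fun i j : Fin n => h i (x j))

/-- The linear combination `S_b = ∑ b_j h_j` of the first `n` functions. -/
noncomputable def linComb (h : ℕ → ℝ → ℝ) {n : ℕ} (b : Fin n → ℝ) (x : ℝ) : ℝ :=
  ∑ j : Fin n, b j * h j x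

/-- The zeros of `f` in `]0,1[`. -/
def zeroSet (f : ℝ → ℝ) : Set ℝ :=
  {x | x ∈ Ioo (0 : ℝ) 1 ∧ f x = 0}

/-- The nodal domains of `f` in `]0,1[`: the connected components of the complement in `]0,1[` of
the zeros of `f`. -/
def nodalDomains (f : ℝ → ℝ) : Set (Set ℝ) :=
  {ω | ∃ x ∈ Ioo (0 : ℝ) 1 \ zeroSet f, ω = connectedComponentIn (Ioo (0 : ℝ) 1 \ zeroSet f) x}

/-! Everything follows from Sturm's bound (`zeroSet_linComb_encard_le`): a nontrivial combination of
the first n eigenfunctions has at most n-1 zeros. Given it, a vanishing Slater determinant at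
distinct points would produce a combination with n zeros, and two combinations sharing n-1 zeros are
proportional.

The bound is proved by Liouville's method. Divide S by the nonvanishing ground state, apply Rolle,
then apply Rolle again to the Wronskian, which also vanishes at 0 and 1: multiplying the
coefficients by λ_0 - λ_j loses no zeros (`exists_zeros_mul_sub`). Iterated and normalised, this
isolates the last eigenfunction present, h_N. Its zeros are simple, so zeros neither merge nor reach
the boundary in the limit (`exists_zeros_of_tendsto`), and h_N inherits them all.

It remains to see that h_N has at most N zeros (`IsDirichletEigenpairs.exists_solvesSystem`). Too
many zeros make the Prüfer angle at 1 so large that, by continuity in μ, more than N eigenvalues lie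
below λ_N. -/

/-! ### The Prüfer angle -/

/-- `θ` is the Prüfer angle, vanishing at `0`, of the equation `-u'' + q u = μ u` on `[0,1]`. -/
def IsPruferAngle (q : ℝ → ℝ) (μ : ℝ) (θ : ℝ → ℝ) : Prop :=
  θ 0 = 0 ∧ ∀ x ∈ Icc (0 : ℝ) 1,
    HasDerivAt θ (Real.cos (θ x) ^ 2 + (μ - q x) * Real.sin (θ x) ^ 2) x

/-- `(u, v)` solves the first order system `u' = v`, `v' = (q - μ) u` on `[0,1]`. -/
def SolvesSystem (q : ℝ → ℝ) (μ : ℝ) (u v : ℝ → ℝ) : Prop :=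
  ∀ x ∈ Icc (0 : ℝ) 1, HasDerivAt u (v x) x ∧ HasDerivAt v ((q x - μ) * u x) x

lemma abs_pruferField_le {a M μ : ℝ} (ha : |a| ≤ M) (t : ℝ) :
    |Real.cos t ^ 2 + (μ - a) * Real.sin t ^ 2| ≤ |μ| + M + 1 := by
  have h1 := Real.sin_sq_add_cos_sq t
  have h2 := sq_nonneg (Real.sin t)
  have h3 := sq_nonneg (Real.cos t)
  have h4 : |μ - a| ≤ |μ| + M := (abs_sub _ _).trans (by linarith)
  calc _ ≤ |Real.cos t ^ 2| + |(μ - a) * Real.sin t ^ 2| := abs_add_le _ _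
    _ ≤ 1 + (|μ| + M) * 1 := by
      rw [abs_mul, abs_of_nonneg h3, abs_of_nonneg h2]
      gcongr
      · linarith
      · exact (abs_nonneg _).trans h4
      · linarith
    _ = _ := by ring

lemma lipschitzWith_pruferField {a M μ : ℝ} (ha : |a| ≤ M) :
    LipschitzWith (Real.toNNReal (2 * (|μ| + M + 1)))
      (fun t : ℝ => Real.cos t ^ 2 + (μ - a) * Real.sin t ^ 2) := by
  have hd : ∀ t : ℝ, HasDerivAt (fun t : ℝ => Real.cos t ^ 2 + (μ - a) * Real.sin t ^ 2)
      ((μ - a - 1) * (2 * (Real.sin t * Real.cos t))) t := fun t => by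
    convert! ((Real.hasDerivAt_cos t).pow 2).add
      (((Real.hasDerivAt_sin t).pow 2).const_mul (μ - a)) using 1
    ring
  refine lipschitzWith_of_nnnorm_deriv_le (fun t => (hd t).differentiableAt) fun t => ?_
  rw [(hd t).deriv, ← NNReal.coe_le_coe, coe_nnnorm, Real.norm_eq_abs]
  refine le_trans ?_ (Real.le_coe_toNNReal _)
  have h1 := Real.sin_sq_add_cos_sq t
  have h4 : |μ - a| ≤ |μ| + M := (abs_sub _ _).trans (by linarith)
  have h5 : |μ - a - 1| ≤ |μ| + M + 1 := (abs_sub _ _).trans (by rw [abs_one]; linarith)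
  have h6 : |2 * (Real.sin t * Real.cos t)| ≤ 1 := by
    rw [abs_le]; constructor <;> nlinarith [sq_nonneg (Real.sin t + Real.cos t),
      sq_nonneg (Real.sin t - Real.cos t)]
  rw [abs_mul]
  have h7 : 0 ≤ |μ| + M + 1 := (abs_nonneg _).trans h5
  nlinarith [abs_nonneg (μ - a - 1), abs_nonneg (2 * (Real.sin t * Real.cos t))]

lemma exists_isPruferAngle {q : ℝ → ℝ} (hq : Continuous q) {M : ℝ} (hM : ∀ x, |q x| ≤ M) (μ : ℝ) :
    ∃ θ, IsPruferAngle q μ θ := by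
  have hA : 0 ≤ |μ| + M + 1 := (abs_nonneg _).trans (abs_pruferField_le (hM 0) 0)
  have hpl : IsPicardLindelof
      (fun t s : ℝ => Real.cos s ^ 2 + (μ - q t) * Real.sin s ^ 2)
      -- Solving on [-1,2] gives two-sided derivatives at 0 and 1. The field is bounded by |μ|+M+1
      -- and time runs at most 2 from 0, hence the radius 2(|μ|+M+1).
      (tmin := -1) (tmax := 2) ⟨0, by norm_num, by norm_num⟩ 0
      (Real.toNNReal (2 * (|μ| + M + 1))) 0 (Real.toNNReal (|μ| + M + 1))
      (Real.toNNReal (2 * (|μ| + M + 1))) :=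
    { lipschitzOnWith := fun t _ => (lipschitzWith_pruferField (hM t)).lipschitzOnWith
      continuousOn := fun x _ => by fun_prop
      norm_le := fun t _ x _ => (abs_pruferField_le (hM t) x).trans (Real.le_coe_toNNReal _)
      mul_max_le := by
        rw [Real.coe_toNNReal _ hA, Real.coe_toNNReal _ (by positivity)]
        norm_num
        linarith }
  obtain ⟨θ, h0, hθ⟩ := hpl.exists_eq_forall_mem_Icc_hasDerivWithinAt₀
  refine ⟨θ, h0, fun x hx => (hθ x ⟨by linarith [hx.1], by linarith [hx.2]⟩).hasDerivAt ?_⟩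
  exact Icc_mem_nhds (by linarith [hx.1]) (by linarith [hx.2])

namespace IsPruferAngle

variable {q : ℝ → ℝ} {μ : ℝ} {θ : ℝ → ℝ}

lemma continuousOn (hθ : IsPruferAngle q μ θ) : ContinuousOn θ (Icc 0 1) :=
  fun x hx => (hθ.2 x hx).continuousAt.continuousWithinAt

/-- Gronwall: moving μ₀ to μ perturbs the field by at most |μ - μ₀|. -/
lemma continuous_eval_one {M : ℝ} (hM : ∀ x, |q x| ≤ M) {θ : ℝ → ℝ → ℝ}
    (hθ : ∀ μ, IsPruferAngle q μ (θ μ)) : Continuous fun μ => θ μ 1 := by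
  rw [continuous_iff_continuousAt]
  intro μ₀
  have key : ∀ μ, dist (θ μ 1) (θ μ₀ 1) ≤
      gronwallBound 0 (Real.toNNReal (2 * (|μ₀| + M + 1)) : ℝ) (|μ - μ₀| + 0) (1 - 0) := by
    intro μ
    refine dist_le_of_approx_trajectories_ODE (a := 0) (b := 1)
      (v := fun t s : ℝ => Real.cos s ^ 2 + (μ₀ - q t) * Real.sin s ^ 2)
      (fun t => lipschitzWith_pruferField (hM t)) (hθ μ).continuousOn
      (fun t ht => ((hθ μ).2 t ⟨ht.1, ht.2.le⟩).hasDerivWithinAt) (fun t ht => ?_)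
      (hθ μ₀).continuousOn
      (fun t ht => ((hθ μ₀).2 t ⟨ht.1, ht.2.le⟩).hasDerivWithinAt) (fun t ht => ?_) ?_ 1 (by simp)
    · rw [Real.dist_eq]
      have : Real.cos (θ μ t) ^ 2 + (μ - q t) * Real.sin (θ μ t) ^ 2 -
          (Real.cos (θ μ t) ^ 2 + (μ₀ - q t) * Real.sin (θ μ t) ^ 2) =
          (μ - μ₀) * Real.sin (θ μ t) ^ 2 := by ring
      rw [this, abs_mul, abs_of_nonneg (sq_nonneg (Real.sin _))]
      exact mul_le_of_le_one_right (abs_nonneg _) (Real.sin_sq_le_one _)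
    · rw [dist_self]
    · rw [(hθ μ).1, (hθ μ₀).1, dist_self]
  rw [ContinuousAt, tendsto_iff_dist_tendsto_zero]
  refine squeeze_zero (fun _ => dist_nonneg) key ?_
  have hc : Continuous fun μ : ℝ =>
      gronwallBound 0 (Real.toNNReal (2 * (|μ₀| + M + 1)) : ℝ) (|μ - μ₀| + 0) (1 - 0) :=
    (gronwallBound_continuous_ε _ _ _).comp (by fun_prop)
  convert! hc.tendsto μ₀ using 2
  simp [gronwallBound_ε0_δ0]

/-- Where sin θ = 0 the equation gives θ' = 1, whatever μ and q, so a multiple of π can only be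
crossed upwards. A return to the same value at x would contradict θ'(x) = 1. -/
lemma lt_of_sin_eq_zero (hθ : IsPruferAngle q μ θ) {a x : ℝ} (ha : 0 ≤ a) (hx : x ≤ 1)
    (hax : a < x) (hs : Real.sin (θ a) = 0) : θ a < θ x := by
  have hc : Real.cos (θ a) ^ 2 = 1 := by have := Real.sin_sq_add_cos_sq (θ a); simp_all
  have hle : ∀ y ∈ Icc a x, θ a ≤ θ y := by
    intro y hy
    have := image_le_of_deriv_right_lt_deriv_boundary' (f := fun y => -θ y)
      (f' := fun y => -(Real.cos (θ y) ^ 2 + (μ - q y) * Real.sin (θ y) ^ 2))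
      (a := a) (b := x) (B := fun _ => -θ a) (B' := fun _ => 0)
      (hθ.continuousOn.mono (Icc_subset_Icc ha hx)).neg
      (fun y hy => (hθ.2 y ⟨ha.trans hy.1, hy.2.le.trans hx⟩).neg.hasDerivWithinAt) le_rfl
      continuousOn_const (fun y _ => hasDerivWithinAt_const _ _ _)
      (fun y _ he => by
        have he : θ y = θ a := neg_injective he
        rw [he, hs, hc]; norm_num) hy
    linarith
  refine lt_of_le_of_ne (hle x ⟨hax.le, le_rfl⟩) fun he => ?_
  have hd := (hθ.2 x ⟨ha.trans hax.le, hx⟩)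
  rw [← he, hs, hc] at hd
  have hd1 : HasDerivAt θ 1 x := by simpa using hd
  have h1 : ∀ᶠ y in nhdsWithin x (Iio x), 0 < slope θ x y :=
    (hd1.tendsto_slope.mono_left (nhdsWithin_mono _ fun y hy => ne_of_lt hy)).eventually
      (lt_mem_nhds one_pos)
  obtain ⟨y, hy1, hy2⟩ := (h1.and (Ioo_mem_nhdsLT hax)).exists
  rw [slope_def_field] at hy1
  have := hle y ⟨hy2.1.le, hy2.2.le⟩
  have : (θ y - θ x) / (y - x) ≤ 0 :=
    div_nonpos_of_nonneg_of_nonpos (by linarith) (by linarith [hy2.2])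
  linarith

/-- The level π/2 is a barrier: there θ' = μ - q < 0. -/
lemma le_pi_div_two (hθ : IsPruferAngle q μ θ) (hμ : ∀ x, μ < q x) :
    θ 1 ≤ Real.pi / 2 := by
  refine image_le_of_deriv_right_lt_deriv_boundary' (f := θ)
      (f' := fun y => (Real.cos (θ y) ^ 2 + (μ - q y) * Real.sin (θ y) ^ 2))
      (a := 0) (b := 1) (B := fun _ => Real.pi / 2) (B' := fun _ => 0)
      hθ.continuousOn
      (fun y hy => (hθ.2 y ⟨hy.1, hy.2.le⟩).hasDerivWithinAt)
      (by rw [hθ.1]; positivity)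
      continuousOn_const (fun y _ => hasDerivWithinAt_const _ _ _)
      (fun y _ he => ?_) ⟨zero_le_one, le_rfl⟩
  simp [he, hμ]

lemma add_pi_le (hθ : IsPruferAngle q μ θ) {a x : ℝ} (ha : 0 ≤ a) (hx : x ≤ 1)
    (hax : a < x) (hs : Real.sin (θ a) = 0) (hsx : Real.sin (θ x) = 0) :
    θ a + Real.pi ≤ θ x := by
  have hlt := hθ.lt_of_sin_eq_zero ha hx hax hs
  obtain ⟨k, hk⟩ := Real.sin_eq_zero_iff.1 hs
  obtain ⟨l, hl⟩ := Real.sin_eq_zero_iff.1 hsx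
  rw [← hk, ← hl] at hlt ⊢
  have h1 : k < l := by exact_mod_cast lt_of_mul_lt_mul_right hlt Real.pi_pos.le
  have h2 : (k : ℝ) + 1 ≤ l := by exact_mod_cast h1
  nlinarith [Real.pi_pos]

/-- The n interior zeros and the endpoints bound n+1 gaps, and θ gains at least π over each. -/
lemma mul_pi_le_of_zeros (hθ : IsPruferAngle q μ θ) (h1 : Real.sin (θ 1) = 0) {n : ℕ}
    {z : Fin n → ℝ} (hz : z ∈ openSimplex n) (hs : ∀ i, Real.sin (θ (z i)) = 0) :
    ((n : ℝ) + 1) * Real.pi ≤ θ 1 := by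
  have key : ∀ (i : ℕ) (hi : i < n), ((i : ℝ) + 1) * Real.pi ≤ θ (z ⟨i, hi⟩) := by
    intro i
    induction i with
    | zero =>
      intro hi
      have := hθ.add_pi_le le_rfl (hz.2 ⟨0, hi⟩).2.le (hz.2 ⟨0, hi⟩).1 (by simp [hθ.1]) (hs _)
      rw [hθ.1] at this
      simpa using this
    | succ i ih =>
      intro hi
      have h2 := ih (by omega)
      have := hθ.add_pi_le (hz.2 ⟨i, by omega⟩).1.le (hz.2 ⟨i + 1, hi⟩).2.le
        (hz.1 (Fin.mk_lt_mk.2 (Nat.lt_succ_self i))) (hs _) (hs _)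
      push_cast
      linarith
  rcases n with _ | n
  · have := hθ.add_pi_le le_rfl le_rfl zero_lt_one (by simp [hθ.1]) h1
    rw [hθ.1] at this
    simpa using this
  · have h2 := key n (by omega)
    have := hθ.add_pi_le (hz.2 ⟨n, by omega⟩).1.le le_rfl (hz.2 ⟨n, by omega⟩).2 (hs _) h1
    push_cast
    linarith

/-- The Prüfer angle, together with a suitable amplitude, gives a solution of the equation. -/
lemma exists_amplitude (hq : Continuous q) (hθ : IsPruferAngle q μ θ) :
    ∃ r : ℝ → ℝ, (∀ x, 0 < r x) ∧
      SolvesSystem q μ (fun x => r x * Real.sin (θ x)) (fun x => r x * Real.cos (θ x)) := by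
  -- The logarithmic derivative of r, forced by (r sin θ)' = r cos θ.
  set g : ℝ → ℝ := fun x => (1 - μ + q x) * (Real.sin (θ x) * Real.cos (θ x)) with hg
  have hgc : ContinuousOn g (Icc 0 1) := by
    have := hθ.continuousOn
    exact ((continuous_const.add hq).continuousOn).mul
      ((Real.continuous_sin.comp_continuousOn this).mul (Real.continuous_cos.comp_continuousOn this))
  set G : ℝ → ℝ := IccExtend (zero_le_one' ℝ) ((Icc (0 : ℝ) 1).domRestrict g) with hG
  have hGc : Continuous G := (continuousOn_iff_continuous_domRestrict.1 hgc).Icc_extend'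
  have hGg : ∀ x ∈ Icc (0 : ℝ) 1, G x = g x := fun x hx => by
    rw [hG, IccExtend_of_mem _ _ hx]; rfl
  refine ⟨fun x => Real.exp (∫ t in (0 : ℝ)..x, G t), fun x => Real.exp_pos _, fun x hx => ?_⟩
  have hr : HasDerivAt (fun x => Real.exp (∫ t in (0 : ℝ)..x, G t))
      (Real.exp (∫ t in (0 : ℝ)..x, G t) * g x) x := by
    rw [← hGg x hx]
    exact (hGc.integral_hasStrictDerivAt 0 x).hasDerivAt.exp
  have ht := hθ.2 x hx
  have h1 := Real.sin_sq_add_cos_sq (θ x)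
  constructor
  · convert! hr.mul ht.sin using 1
    simp only [hg]
    linear_combination
      (-Real.exp (∫ t in (0 : ℝ)..x, G t) * Real.cos (θ x)) * h1
  · convert! hr.mul ht.cos using 1
    simp only [hg]
    linear_combination
      (-Real.exp (∫ t in (0 : ℝ)..x, G t) * Real.sin (θ x) * (q x - μ)) * h1
end IsPruferAngle

/-! ### Eigenfunctions and the first order system -/

lemma IsDirichletEigenfunction.congr_potential {q₁ q₂ : ℝ → ℝ} (hq : EqOn q₁ q₂ (Icc 0 1)) {μ : ℝ}
    {u : ℝ → ℝ} (hu : IsDirichletEigenfunction q₁ μ u) : IsDirichletEigenfunction q₂ μ u :=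
  { hu with eqn := fun x hx => by rw [← hq (Ioo_subset_Icc_self hx)]; exact hu.eqn x hx }

lemma IsDirichletEigenpairs.congr_potential {q₁ q₂ : ℝ → ℝ} (hq : EqOn q₁ q₂ (Icc 0 1))
    {lam : ℕ → ℝ} {h : ℕ → ℝ → ℝ} (hh : IsDirichletEigenpairs q₁ lam h) :
    IsDirichletEigenpairs q₂ lam h where
  strictMono := hh.strictMono
  range_eq := by
    rw [hh.range_eq]
    ext μ
    exact ⟨fun ⟨u, hu⟩ => ⟨u, hu.congr_potential hq⟩, fun ⟨u, hu⟩ => ⟨u, hu.congr_potential hq.symm⟩⟩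
  eigenfunction j := (hh.eigenfunction j).congr_potential hq

lemma SolvesSystem.isDirichletEigenfunction {q : ℝ → ℝ} (hq : Continuous q) {μ : ℝ} {u v : ℝ → ℝ}
    (huv : SolvesSystem q μ u v) (hne : ∀ x ∈ Icc (0 : ℝ) 1, u x = 0 → v x ≠ 0)
    (h0 : u 0 = 0) (h1 : u 1 = 0) : IsDirichletEigenfunction q μ u := by
  have hud : UniqueDiffOn ℝ (Icc (0 : ℝ) 1) := uniqueDiffOn_Icc one_pos
  have hu : ContinuousOn u (Icc 0 1) := fun x hx => (huv x hx).1.continuousAt.continuousWithinAt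
  have hvd : ∀ x ∈ Icc (0 : ℝ) 1, derivWithin v (Icc 0 1) x = (q x - μ) * u x := fun x hx =>
    (huv x hx).2.hasDerivWithinAt.derivWithin (hud x hx)
  have hv1 : ContDiffOn ℝ 1 v (Icc 0 1) := by
    rw [show (1 : WithTop ℕ∞) = 0 + 1 by norm_num, contDiffOn_succ_iff_derivWithin hud]
    refine ⟨fun x hx => (huv x hx).2.differentiableAt.differentiableWithinAt, by simp, ?_⟩
    rw [contDiffOn_zero]
    exact ((hq.sub continuous_const).continuousOn.mul hu).congr hvd
  refine ⟨?_, ?_, ?_, h0, h1⟩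
  · rw [show (2 : WithTop ℕ∞) = 1 + 1 by norm_num, contDiffOn_succ_iff_derivWithin hud]
    refine ⟨fun x hx => (huv x hx).1.differentiableAt.differentiableWithinAt, by simp, ?_⟩
    exact hv1.congr fun x hx => (huv x hx).1.hasDerivWithinAt.derivWithin (hud x hx)
  · by_contra! hz
    have hx : (1 / 2 : ℝ) ∈ Ioo (0 : ℝ) 1 := by norm_num
    refine hne _ (Ioo_subset_Icc_self hx) (hz _ hx) ?_
    refine (huv _ (Ioo_subset_Icc_self hx)).1.unique ?_
    refine (hasDerivAt_const (1 / 2 : ℝ) (0 : ℝ)).congr_of_eventuallyEq ?_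
    filter_upwards [Ioo_mem_nhds hx.1 hx.2] with y hy using hz y hy
  · intro x hx
    have : deriv u =ᶠ[nhds x] v := by
      filter_upwards [Ioo_mem_nhds hx.1 hx.2] with y hy
      exact (huv y (Ioo_subset_Icc_self hy)).1.deriv
    rw [this.deriv_eq, (huv x (Ioo_subset_Icc_self hx)).2.deriv]
    ring

/-- The equation, assumed only inside the interval, reaches the endpoints because h is C² up to the
boundary. -/
lemma IsDirichletEigenfunction.exists_hasDerivWithinAt {q : ℝ → ℝ} (hq : Continuous q) {μ : ℝ}
    {h : ℝ → ℝ} (hh : IsDirichletEigenfunction q μ h) :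
    ∃ p : ℝ → ℝ, ∀ x ∈ Icc (0 : ℝ) 1, HasDerivWithinAt h (p x) (Icc 0 1) x ∧
      HasDerivWithinAt p ((q x - μ) * h x) (Icc 0 1) x := by
  have hud : UniqueDiffOn ℝ (Icc (0 : ℝ) 1) := uniqueDiffOn_Icc one_pos
  have h2 := hh.contDiffOn
  rw [show (2 : WithTop ℕ∞) = 1 + 1 by norm_num, contDiffOn_succ_iff_derivWithin hud] at h2
  obtain ⟨hd, -, h1⟩ := h2
  set p := derivWithin h (Icc 0 1) with hp
  rw [show (1 : WithTop ℕ∞) = 0 + 1 by norm_num, contDiffOn_succ_iff_derivWithin hud,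
    contDiffOn_zero] at h1
  obtain ⟨hpd, -, hpc⟩ := h1
  refine ⟨p, fun x hx => ⟨(hd x hx).hasDerivWithinAt, ?_⟩⟩
  have heq : EqOn (derivWithin p (Icc 0 1)) (fun x => (q x - μ) * h x) (Ioo 0 1) := by
    intro y hy
    have he : deriv h =ᶠ[nhds y] p := by
      filter_upwards [Ioo_mem_nhds hy.1 hy.2] with z hz
      exact (derivWithin_of_mem_nhds (Icc_mem_nhds hz.1 hz.2)).symm
    have := hh.eqn y hy
    rw [he.deriv_eq, ← derivWithin_of_mem_nhds (Icc_mem_nhds hy.1 hy.2)] at this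
    simp only
    linarith
  have := heq.of_subset_closure hpc
    ((hq.sub continuous_const).continuousOn.mul hd.continuousOn) Ioo_subset_Icc_self
    (by rw [closure_Ioo (by norm_num)])
  have h3 := (hpd x hx).hasDerivWithinAt
  rwa [this hx] at h3

/-- A Dirichlet eigenfunction is proportional to the solution of the initial value problem. -/
lemma IsDirichletEigenfunction.exists_eq_mul {q : ℝ → ℝ} (hq : Continuous q) {M : ℝ}
    (hM : ∀ x, |q x| ≤ M) {μ : ℝ} {h u v : ℝ → ℝ} (hh : IsDirichletEigenfunction q μ h)
    (huv : SolvesSystem q μ u v) (h0 : u 0 = 0) (hv0 : v 0 ≠ 0) :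
    ∃ c : ℝ, c ≠ 0 ∧ ∀ x ∈ Icc (0 : ℝ) 1, h x = c * u x := by
  obtain ⟨p, hp⟩ := hh.exists_hasDerivWithinAt hq
  have hlip : ∀ t, LipschitzWith (Real.toNNReal (|μ| + M + 1))
      (fun y : ℝ × ℝ => (y.2, (q t - μ) * y.1)) := by
    intro t
    have hq' : |q t - μ| ≤ |μ| + M := (abs_sub _ _).trans (by linarith [hM t])
    have hA := abs_nonneg (q t - μ)
    refine LipschitzWith.of_dist_le_mul fun y z => ?_
    rw [Real.coe_toNNReal _ (by linarith), Prod.dist_eq, Prod.dist_eq]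
    refine max_le ?_ ?_
    · exact (le_max_right _ _).trans (le_mul_of_one_le_left (by positivity) (by linarith))
    · simp only [Real.dist_eq]
      rw [← mul_sub, abs_mul]
      exact mul_le_mul (by linarith) (le_max_left _ _) (abs_nonneg _) (by linarith)
  have hmem : ∀ t ∈ Ico (0 : ℝ) 1, Icc (0 : ℝ) 1 ∈ nhdsWithin t (Ici t) := fun t ht =>
    Filter.mem_of_superset (Icc_mem_nhdsGE ht.2) (Icc_subset_Icc_left ht.1)
  -- This c matches the initial data: both solutions start at (0, p 0).
  set c := p 0 / v 0 with hc
  have huniq : EqOn (fun x => (h x, p x)) (fun x => (c * u x, c * v x)) (Icc 0 1) := by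
    refine ODE_solution_unique (v := fun t (y : ℝ × ℝ) => (y.2, (q t - μ) * y.1)) hlip
      (fun x hx => ((hp x hx).1.continuousWithinAt).prodMk (hp x hx).2.continuousWithinAt)
      (fun t ht => ?_) (fun x hx => ?_) (fun t ht => ?_) ?_
    · have := hp t ⟨ht.1, ht.2.le⟩
      exact (this.1.mono_of_mem_nhdsWithin (hmem t ht)).prodMk
        (this.2.mono_of_mem_nhdsWithin (hmem t ht))
    · exact (((huv x hx).1.const_mul c).continuousAt.prodMk
        ((huv x hx).2.const_mul c).continuousAt).continuousWithinAt
    · have := huv t ⟨ht.1, ht.2.le⟩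
      convert! ((this.1.const_mul c).prodMk (this.2.const_mul c)).hasDerivWithinAt using 2
      ring
    · simp [hh.left, h0, hc, div_mul_cancel₀ _ hv0]
  have hux : ∀ x ∈ Icc (0 : ℝ) 1, h x = c * u x := fun x hx => congrArg Prod.fst (huniq hx)
  refine ⟨c, fun hc0 => ?_, hux⟩
  obtain ⟨x, hx, hne⟩ := hh.ne_zero
  exact hne (by rw [hux x (Ioo_subset_Icc_self hx), hc0, zero_mul])

/-! ### Zeros of a single eigenfunction -/

/-- The `j`-th eigenfunction agrees on `[0,1]` with a solution `u` of the first order system whose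
zeros are simple and which has at most `j` zeros in `]0,1[`. -/
lemma IsDirichletEigenpairs.exists_solvesSystem {q : ℝ → ℝ} (hq : Continuous q) {M : ℝ}
    (hM : ∀ x, |q x| ≤ M) {lam : ℕ → ℝ} {h : ℕ → ℝ → ℝ} (hh : IsDirichletEigenpairs q lam h)
    (j : ℕ) :
    ∃ u v : ℝ → ℝ, SolvesSystem q (lam j) u v ∧ EqOn (h j) u (Icc 0 1) ∧
      (∀ x ∈ Icc (0 : ℝ) 1, u x = 0 → v x ≠ 0) ∧
      ∀ z ∈ openSimplex (j + 1), ¬ ∀ i, u (z i) = 0 := by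
  choose θ hθ using exists_isPruferAngle hq hM
  choose r hr hsys using fun μ => (hθ μ).exists_amplitude hq
  have hsc : ∀ μ x, r μ x * Real.sin (θ μ x) = 0 → r μ x * Real.cos (θ μ x) ≠ 0 := by
    intro μ x hs hc
    have h1 := (mul_eq_zero.1 hs).resolve_left (hr μ x).ne'
    have h2 := (mul_eq_zero.1 hc).resolve_left (hr μ x).ne'
    have := Real.sin_sq_add_cos_sq (θ μ x)
    simp [h1, h2] at this
  have hu0 : ∀ μ, r μ 0 * Real.sin (θ μ 0) = 0 := fun μ => by simp [(hθ μ).1]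
  obtain ⟨c, hc0, hc⟩ := (hh.eigenfunction j).exists_eq_mul hq hM (hsys (lam j)) (hu0 _)
    (hsc _ _ (hu0 _))
  refine ⟨fun x => c * (r (lam j) x * Real.sin (θ (lam j) x)),
    fun x => c * (r (lam j) x * Real.cos (θ (lam j) x)), fun x hx => ⟨?_, ?_⟩, hc, ?_, ?_⟩
  · exact (hsys _ x hx).1.const_mul c
  · convert! (hsys _ x hx).2.const_mul c using 1
    ring
  · intro x _ hx
    exact mul_ne_zero hc0 (hsc _ _ ((mul_eq_zero.1 hx).resolve_left hc0))
  intro z hz hzero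
  have hsin : ∀ x, c * (r (lam j) x * Real.sin (θ (lam j) x)) = 0 → Real.sin (θ (lam j) x) = 0 :=
    fun x hx => (mul_eq_zero.1 ((mul_eq_zero.1 hx).resolve_left hc0)).resolve_left (hr _ x).ne'
  have h1 : Real.sin (θ (lam j) 1) = 0 :=
    hsin 1 (by rw [← hc 1 (by simp)]; exact (hh.eigenfunction j).right)
  have hbig := (hθ (lam j)).mul_pi_le_of_zeros h1 hz fun i => hsin _ (hzero i)
  have hcont := IsPruferAngle.continuous_eval_one hM hθ
  -- Below the minimum of q, so that the angle at 1 is at most π/2 < π.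
  set μ₀ := min (lam j) (-M - 1) with hμ₀
  have hlow : θ μ₀ 1 ≤ Real.pi / 2 := (hθ μ₀).le_pi_div_two fun x => by
    have := (abs_le.1 (hM x)).1
    have := min_le_right (lam j) (-M - 1)
    linarith
  have hpi := Real.pi_pos
  -- With j+1 zeros the angle at 1 for λ_j is at least (j+2)π, so each level π, …, (j+1)π is
  -- attained at some μ < λ_j, necessarily an eigenvalue. That puts j+1 distinct eigenvalues below
  -- λ_j, where only j exist. Monotonicity in μ is not needed.
  have hex : ∀ i : Fin (j + 1), ∃ k : Fin j, θ (lam k) 1 = ((i : ℝ) + 1) * Real.pi := by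
    intro i
    have hi : (i : ℝ) + 1 ≤ j + 1 := by exact_mod_cast i.2
    have hi0 : (0 : ℝ) ≤ (i : ℝ) := Nat.cast_nonneg _
    push_cast at hbig
    obtain ⟨μ, hμ, he⟩ := intermediate_value_Icc (min_le_left (lam j) (-M - 1))
      hcont.continuousOn (show ((i : ℝ) + 1) * Real.pi ∈ Icc (θ μ₀ 1) (θ (lam j) 1) from
        ⟨by nlinarith, by nlinarith⟩)
    have hspec : μ ∈ range lam := by
      rw [hh.range_eq]
      refine ⟨_, (hsys μ).isDirichletEigenfunction hq (fun x _ => hsc μ x) (hu0 μ) ?_⟩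
      have : Real.sin (((i : ℝ) + 1) * Real.pi) = 0 := by exact_mod_cast Real.sin_nat_mul_pi (i + 1)
      simp only at he
      rw [he, this, mul_zero]
    obtain ⟨k, rfl⟩ := hspec
    simp only at he
    refine ⟨⟨k, ?_⟩, he⟩
    refine hh.strictMono.lt_iff_lt.1 (lt_of_le_of_ne hμ.2 fun hk => ?_)
    rw [hk] at he
    nlinarith
  choose k hk using hex
  have hinj : Function.Injective k := by
    intro a b hab
    have h2 := hk a
    rw [hab, hk b] at h2
    have h3 := mul_right_cancel₀ hpi.ne' h2
    have h4 : (b : ℝ) = a := by linarith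
    exact Fin.ext (by exact_mod_cast h4.symm)
  have := Fintype.card_le_of_injective k hinj
  simp at this

/-! ### Rolle's theorem and tuples with endpoints -/

/-- Rolle's theorem for a strictly increasing tuple of zeros. -/
lemma exists_strictMono_deriv_eq_zero {s : Set ℝ} (hs : s.OrdConnected) {f f' : ℝ → ℝ}
    (hf : ∀ x ∈ s, HasDerivAt f (f' x) x) {n : ℕ} {c : Fin (n + 1) → ℝ} (hc : StrictMono c)
    (hcs : ∀ i, c i ∈ s) (h0 : ∀ i, f (c i) = 0) :
    ∃ d : Fin n → ℝ, StrictMono d ∧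
      ∀ i, d i ∈ Ioo (c i.castSucc) (c i.succ) ∧ f' (d i) = 0 := by
  have hsub : ∀ i : Fin n, Icc (c i.castSucc) (c i.succ) ⊆ s := fun i => hs.out (hcs _) (hcs _)
  have : ∀ i : Fin n, ∃ x ∈ Ioo (c i.castSucc) (c i.succ), f' x = 0 := fun i =>
    exists_hasDerivAt_eq_zero (hc i.castSucc_lt_succ)
      (fun x hx => (hf x (hsub i hx)).continuousAt.continuousWithinAt) (by rw [h0, h0])
      (fun x hx => hf x (hsub i (Ioo_subset_Icc_self hx)))
  choose d hd hd0 using this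
  refine ⟨d, fun i j hij => ?_, fun i => ⟨hd i, hd0 i⟩⟩
  calc d i < c i.succ := (hd i).2
    _ ≤ c j.castSucc := hc.monotone (Fin.succ_le_castSucc_iff.2 hij)
    _ < d j := (hd j).1

/-- The tuple `(0, z_1, …, z_n, 1)`. -/
def addEndpoints {n : ℕ} (z : Fin n → ℝ) : Fin (n + 2) → ℝ :=
  Fin.cons 0 (Fin.snoc z 1 : Fin (n + 1) → ℝ)

section addEndpoints

variable {n : ℕ} (z : Fin n → ℝ)

@[simp] lemma addEndpoints_zero : addEndpoints z 0 = 0 := rfl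

@[simp] lemma addEndpoints_last : addEndpoints z (Fin.last _) = 1 := by
  rw [addEndpoints, ← Fin.succ_last, Fin.cons_succ, Fin.snoc_last]

@[simp] lemma addEndpoints_inner (i : Fin n) : addEndpoints z i.castSucc.succ = z i := by
  rw [addEndpoints, Fin.cons_succ, Fin.snoc_castSucc]

variable {z}

lemma forall_addEndpoints {p : ℝ → Prop} (h0 : p 0) (h1 : p 1) (h : ∀ i, p (z i)) (i) :
    p (addEndpoints z i) := by
  cases i using Fin.cases with
  | zero => simpa
  | succ i =>
    cases i using Fin.lastCases with
    | last => rwa [Fin.succ_last, addEndpoints_last]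
    | cast i => rw [addEndpoints_inner]; exact h i

lemma addEndpoints_mem_Icc (hz : z ∈ openSimplex n) (i) : addEndpoints z i ∈ Icc (0 : ℝ) 1 :=
  forall_addEndpoints (p := (· ∈ Icc (0 : ℝ) 1)) (by simp) (by simp)
    (fun i => Ioo_subset_Icc_self (hz.2 i)) i

lemma strictMono_addEndpoints (hz : z ∈ openSimplex n) : StrictMono (addEndpoints z) := by
  intro i j hij
  cases j using Fin.cases with
  | zero => exact absurd hij (Fin.not_lt_zero i)
  | succ j =>
    cases i using Fin.cases with
    | zero =>
      cases j using Fin.lastCases with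
      | last => simp [Fin.succ_last]
      | cast j => simpa using (hz.2 j).1
    | succ i =>
      cases i using Fin.lastCases with
      | last => exact absurd (Fin.succ_lt_succ_iff.1 hij) (not_lt.2 (Fin.le_last j))
      | cast i =>
        cases j using Fin.lastCases with
        | last => rw [Fin.succ_last, addEndpoints_last, addEndpoints_inner]; exact (hz.2 i).2
        | cast j =>
          rw [addEndpoints_inner, addEndpoints_inner]
          exact hz.1 (by simpa using hij)

lemma mem_openSimplex_of_addEndpoints {e : Fin (n + 2) → ℝ} (he : StrictMono e) (h0 : e 0 = 0)
    (h1 : e (Fin.last _) = 1) : (fun i : Fin n => e i.castSucc.succ) ∈ openSimplex n := by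
  refine ⟨fun i j hij => he (by simpa using hij), fun i => ⟨?_, ?_⟩⟩
  · rw [← h0]; exact he (Fin.succ_pos _)
  · rw [← h1, ← Fin.succ_last]; exact he (Fin.succ_lt_succ_iff.2 (Fin.castSucc_lt_last i))

end addEndpoints

/-! ### Liouville's proof of Sturm's bound -/

section Liouville

variable {q : ℝ → ℝ} {lam : ℕ → ℝ} {u v : ℕ → ℝ → ℝ}

/-- Liouville's step: passing from `∑ b_j u_j` to `∑ (λ_0 - λ_j) b_j u_j` does not decrease the
number of zeros. -/
lemma exists_zeros_mul_sub (hsys : ∀ j, SolvesSystem q (lam j) (u j) (v j))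
    (h0 : ∀ j, u j 0 = 0) (h1 : ∀ j, u j 1 = 0) (hpos : ∀ x ∈ Ioo (0 : ℝ) 1, u 0 x ≠ 0)
    (N : ℕ) (b : ℕ → ℝ) {n : ℕ} {z : Fin n → ℝ} (hz : z ∈ openSimplex n)
    (hz0 : ∀ i, ∑ j ∈ Finset.range N, b j * u j (z i) = 0) :
    ∃ w ∈ openSimplex n, ∀ i, ∑ j ∈ Finset.range N, b j * (lam 0 - lam j) * u j (w i) = 0 := by
  rcases n with _ | n
  · exact ⟨z, hz, fun i => i.elim0⟩
  set F : ℝ → ℝ := fun x => ∑ j ∈ Finset.range N, b j * u j x with hF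
  set G : ℝ → ℝ := fun x => ∑ j ∈ Finset.range N, b j * v j x with hG
  have hFd : ∀ x ∈ Icc (0 : ℝ) 1, HasDerivAt F (G x) x := fun x hx =>
    HasDerivAt.fun_sum fun j _ => (hsys j x hx).1.const_mul (b j)
  have hGd : ∀ x ∈ Icc (0 : ℝ) 1,
      HasDerivAt G (∑ j ∈ Finset.range N, b j * ((q x - lam j) * u j x)) x := fun x hx =>
    HasDerivAt.fun_sum fun j _ => (hsys j x hx).2.const_mul (b j)
  obtain ⟨ζ, hζ, hζ0⟩ := exists_strictMono_deriv_eq_zero (s := Ioo 0 1) ordConnected_Ioo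
    (f := fun x => F x / u 0 x) (f' := fun x => (G x * u 0 x - F x * v 0 x) / u 0 x ^ 2)
    (fun x hx => (hFd x (Ioo_subset_Icc_self hx)).div (hsys 0 x (Ioo_subset_Icc_self hx)).1
      (hpos x hx)) hz.1 hz.2 (fun i => by simp only [hF, hz0, zero_div])
  have hζs : ζ ∈ openSimplex n := ⟨hζ, fun i =>
    ⟨(hz.2 _).1.trans (hζ0 i).1.1, (hζ0 i).1.2.trans (hz.2 _).2⟩⟩
  have hF0 : F 0 = 0 := by simp [hF, h0]
  have hF1 : F 1 = 0 := by simp [hF, h1]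
  -- The first Rolle step lost one zero. The Wronskian gains two at the endpoints, so n+1 remain
  -- after the second; its derivative is u_0 Σ (λ_0 - λ_j) b_j u_j.
  obtain ⟨w, hw, hw0⟩ := exists_strictMono_deriv_eq_zero (s := Icc 0 1) ordConnected_Icc
    (f := fun x => G x * u 0 x - F x * v 0 x)
    (fun x hx => ((hGd x hx).mul (hsys 0 x hx).1).sub ((hFd x hx).mul (hsys 0 x hx).2))
    (strictMono_addEndpoints hζs) (addEndpoints_mem_Icc hζs)
    (forall_addEndpoints (p := fun x => G x * u 0 x - F x * v 0 x = 0)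
      (by simp [h0, hF0]) (by simp [h1, hF1]) fun i => by
      have := (hζ0 i).2
      rwa [div_eq_zero_iff, or_iff_left (pow_ne_zero 2 (hpos _ (hζs.2 i)))] at this)
  have hws : w ∈ openSimplex (n + 1) := ⟨hw, fun i =>
    ⟨(addEndpoints_mem_Icc hζs _).1.trans_lt (hw0 i).1.1,
      (hw0 i).1.2.trans_le (addEndpoints_mem_Icc hζs _).2⟩⟩
  refine ⟨w, hws, fun i => ?_⟩
  refine (mul_eq_zero.1 (?_ : u 0 (w i) * _ = 0)).resolve_left (hpos _ (hws.2 i))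
  refine Eq.trans ?_ (hw0 i).2
  have e1 : ∑ j ∈ Finset.range N, b j * (lam 0 - lam j) * u j (w i) =
      ∑ j ∈ Finset.range N, b j * ((q (w i) - lam j) * u j (w i)) -
        (q (w i) - lam 0) * F (w i) := by
    rw [hF, Finset.mul_sum, ← Finset.sum_sub_distrib]
    exact Finset.sum_congr rfl fun j _ => by ring
  rw [e1]
  ring

open Filter Topology in
/-- Zeros persist in the limit, if the limit has only simple zeros. -/
lemma exists_zeros_of_tendsto (hsys : ∀ j, SolvesSystem q (lam j) (u j) (v j))
    (h0 : ∀ j, u j 0 = 0) (h1 : ∀ j, u j 1 = 0) (N : ℕ) {a : ℕ → ℕ → ℝ} {α : ℕ → ℝ}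
    (ha : ∀ j ∈ Finset.range N, Tendsto (fun k => a k j) atTop (𝓝 (α j)))
    (hsimple : ∀ x ∈ Icc (0 : ℝ) 1, ∑ j ∈ Finset.range N, α j * u j x = 0 →
      ∑ j ∈ Finset.range N, α j * v j x ≠ 0) {n : ℕ}
    (hz : ∀ k, ∃ z ∈ openSimplex n, ∀ i, ∑ j ∈ Finset.range N, a k j * u j (z i) = 0) :
    ∃ z ∈ openSimplex n, ∀ i, ∑ j ∈ Finset.range N, α j * u j (z i) = 0 := by
  choose z hzs hz0 using hz
  have hroll := fun k => exists_strictMono_deriv_eq_zero (s := Icc 0 1) ordConnected_Icc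
    (f := fun x => ∑ j ∈ Finset.range N, a k j * u j x)
    (f' := fun x => ∑ j ∈ Finset.range N, a k j * v j x)
    (fun x hx => HasDerivAt.fun_sum fun j _ => (hsys j x hx).1.const_mul (a k j))
    (strictMono_addEndpoints (hzs k)) (addEndpoints_mem_Icc (hzs k))
    (forall_addEndpoints (p := fun x => ∑ j ∈ Finset.range N, a k j * u j x = 0)
      (by simp [h0]) (by simp [h1]) (hz0 k))
  choose d _ hd using hroll
  -- The endpoints are kept in the tuple so that escape of a zero to the boundary is just another
  -- collision.
  obtain ⟨e, he, φ, hφ, hlim⟩ :=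
    (isCompact_univ_pi fun _ : Fin (n + 2) => isCompact_Icc (a := (0 : ℝ)) (b := 1)).tendsto_subseq
      (x := fun k => addEndpoints (z k)) fun k i _ => addEndpoints_mem_Icc (hzs k) i
  have hei : ∀ i, Tendsto (fun k => addEndpoints (z (φ k)) i) atTop (𝓝 (e i)) :=
    fun i => (tendsto_pi_nhds.1 hlim) i
  have heI : ∀ i, e i ∈ Icc (0 : ℝ) 1 := fun i => he i (mem_univ i)
  have hpass : ∀ w : ℕ → ℝ → ℝ, (∀ j, ∀ x ∈ Icc (0 : ℝ) 1, ContinuousAt (w j) x) →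
      ∀ (y : ℕ → ℝ) (x : ℝ), x ∈ Icc (0 : ℝ) 1 → Tendsto y atTop (𝓝 x) →
      (∀ k, ∑ j ∈ Finset.range N, a (φ k) j * w j (y k) = 0) →
      ∑ j ∈ Finset.range N, α j * w j x = 0 := by
    intro w hw y x hx hy hy0
    have : Tendsto (fun k => ∑ j ∈ Finset.range N, a (φ k) j * w j (y k)) atTop
        (𝓝 (∑ j ∈ Finset.range N, α j * w j x)) :=
      tendsto_finsetSum _ fun j hj =>
        ((ha j hj).comp hφ.tendsto_atTop).mul ((hw j x hx).tendsto.comp hy)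
    simp only [hy0] at this
    exact (tendsto_nhds_unique this tendsto_const_nhds)
  have hzero : ∀ i, ∑ j ∈ Finset.range N, α j * u j (e i) = 0 := fun i =>
    hpass u (fun j x hx => (hsys j x hx).1.continuousAt) _ _ (heI i) (hei i) fun k =>
      forall_addEndpoints (p := fun t => ∑ j ∈ Finset.range N, a (φ k) j * u j t = 0)
        (by simp [h0]) (by simp [h1]) (hz0 (φ k)) i
  -- If two neighbours merge, the Rolle point between them converges to the same place, which is
  -- then a double zero of the limit.
  have hmono : StrictMono e := by
    refine Fin.strictMono_iff_lt_succ.2 fun i => lt_of_le_of_ne ?_ fun heq => ?_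
    · exact le_of_tendsto_of_tendsto' (hei _) (hei _) fun k =>
        (strictMono_addEndpoints (hzs (φ k))).monotone (Fin.castSucc_le_succ i)
    · refine hsimple _ (heI _) (hzero i.castSucc) ?_
      refine hpass v (fun j x hx => (hsys j x hx).2.continuousAt) (fun k => d (φ k) i) _ (heI _)
        ?_ fun k => (hd (φ k) i).2
      exact tendsto_of_tendsto_of_tendsto_of_le_of_le (hei i.castSucc) (heq ▸ hei i.succ)
        (fun k => (hd (φ k) i).1.1.le) fun k => (hd (φ k) i).1.2.le
  refine ⟨_, mem_openSimplex_of_addEndpoints hmono ?_ ?_, fun i => hzero _⟩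
  · have := hei 0
    simp only [addEndpoints_zero] at this
    exact tendsto_nhds_unique this tendsto_const_nhds
  · have := hei (Fin.last _)
    simp only [addEndpoints_last] at this
    exact tendsto_nhds_unique this tendsto_const_nhds

open Filter Topology in
/-- Sturm's upper bound for the number of zeros, with a nonzero leading coefficient. -/
lemma not_forall_sum_eq_zero (hlam : StrictMono lam)
    (hsys : ∀ j, SolvesSystem q (lam j) (u j) (v j))
    (h0 : ∀ j, u j 0 = 0) (h1 : ∀ j, u j 1 = 0)
    (hsimple : ∀ j, ∀ x ∈ Icc (0 : ℝ) 1, u j x = 0 → v j x ≠ 0)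
    (hcount : ∀ j, ∀ z ∈ openSimplex (j + 1), ¬ ∀ i, u j (z i) = 0)
    (N : ℕ) {b : ℕ → ℝ} (hb : b N ≠ 0) {z : Fin (N + 1) → ℝ} (hz : z ∈ openSimplex (N + 1)) :
    ¬ ∀ i, ∑ j ∈ Finset.range (N + 1), b j * u j (z i) = 0 := by
  intro hz0
  -- For N = 0 the normalising factor λ_0 - λ_N would vanish.
  rcases Nat.eq_zero_or_pos N with rfl | hN
  · exact hcount 0 z hz fun i => by simpa [hb] using hz0 i
  have hpos : ∀ x ∈ Ioo (0 : ℝ) 1, u 0 x ≠ 0 := fun x hx hx0 =>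
    hcount 0 (fun _ => x) ⟨fun i j hij => absurd hij (by omega), fun _ => hx⟩ fun _ => hx0
  have hne : lam 0 - lam N ≠ 0 := (sub_neg.2 (hlam hN)).ne
  -- ρ_N = 1 and 0 ≤ ρ_j < 1 for j < N, so powers of ρ kill all terms but the last.
  set ρ : ℕ → ℝ := fun j => (lam 0 - lam j) / (lam 0 - lam N) with hρ
  have hiter : ∀ k : ℕ, ∃ w ∈ openSimplex (N + 1),
      ∀ i, ∑ j ∈ Finset.range (N + 1), b j * ρ j ^ k * u j (w i) = 0 := by
    intro k
    induction k with
    | zero => exact ⟨z, hz, by simpa using hz0⟩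
    | succ k ih =>
      obtain ⟨w, hw, hw0⟩ := ih
      obtain ⟨y, hy, hy0⟩ := exists_zeros_mul_sub hsys h0 h1 hpos (N + 1) _ hw hw0
      refine ⟨y, hy, fun i => ?_⟩
      have := congrArg (· / (lam 0 - lam N)) (hy0 i)
      simp only [Finset.sum_div, zero_div] at this
      rw [← this]
      refine Finset.sum_congr rfl fun j _ => ?_
      rw [pow_succ, hρ]
      field_simp
  have hlim : ∀ w : ℕ → ℝ → ℝ, ∀ x,
      ∑ j ∈ Finset.range (N + 1), (if j = N then b N else 0) * w j x = b N * w N x := by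
    intro w x
    simp [ite_mul, Finset.sum_ite_eq']
  have htend : ∀ j ∈ Finset.range (N + 1),
      Tendsto (fun k => b j * ρ j ^ k) atTop (𝓝 (if j = N then b N else 0)) := by
    intro j hj
    by_cases hjN : j = N
    · have : ρ N = 1 := div_self hne
      simp [hjN, this]
    · have hjN' : j < N := lt_of_le_of_ne (Nat.lt_succ_iff.1 (Finset.mem_range.1 hj)) hjN
      have h2 := hlam hjN'
      have h3 := hlam.monotone (Nat.zero_le j)
      have h4 : |ρ j| < 1 := by
        rw [hρ, abs_div, div_lt_one (abs_pos.2 hne), abs_of_nonpos (by linarith),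
          abs_of_nonpos (by linarith)]
        linarith
      simpa [hjN] using (tendsto_pow_atTop_nhds_zero_of_abs_lt_one h4).const_mul (b j)
  obtain ⟨y, hy, hy0⟩ := exists_zeros_of_tendsto hsys h0 h1 (N + 1) htend
    (fun x hx hx0 => by
      rw [hlim] at hx0 ⊢
      exact mul_ne_zero hb (hsimple N x hx ((mul_eq_zero.1 hx0).resolve_left hb))) hiter
  refine hcount N y hy fun i => ?_
  have := hy0 i
  rw [hlim] at this
  exact (mul_eq_zero.1 this).resolve_left hb

end Liouville

/-! ### Nodal domains -/

/-- The complement in `]0,1[` of at most `m` zeros has at most `m + 1` connected components. -/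
lemma encard_nodalDomains_le {f : ℝ → ℝ} {m : ℕ} (hf : (zeroSet f).encard ≤ m) :
    (nodalDomains f).encard ≤ ((m + 1 : ℕ) : ℕ∞) := by
  have hfin : (zeroSet f).Finite := finite_of_encard_le_coe hf
  set Z := hfin.toFinset with hZ
  have hcard : Z.card ≤ m := by
    rw [hfin.encard_eq_coe_toFinset_card] at hf
    exact_mod_cast hf
  -- The number of zeros to the left of x labels its component, with values in 0, …, m.
  set c : ℝ → ℕ := fun x => (Z.filter (· < x)).card with hc
  have key : ∀ x ∈ Ioo (0 : ℝ) 1 \ zeroSet f, ∀ y ∈ Ioo (0 : ℝ) 1 \ zeroSet f, x ≤ y → c x = c y →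
      connectedComponentIn (Ioo (0 : ℝ) 1 \ zeroSet f) x =
        connectedComponentIn (Ioo (0 : ℝ) 1 \ zeroSet f) y := by
    intro x hx y hy hxy hcxy
    refine connectedComponentIn_eq ?_
    refine isPreconnected_Icc.subset_connectedComponentIn (left_mem_Icc.2 hxy) (fun t ht => ?_)
      (right_mem_Icc.2 hxy)
    refine ⟨⟨hx.1.1.trans_le ht.1, ht.2.trans_lt hy.1.2⟩, fun htz => ?_⟩
    have hty : t < y := lt_of_le_of_ne ht.2 fun h => hy.2 (h ▸ htz)
    have hlt : c x < c y := by
      refine Finset.card_lt_card (Finset.ssubset_iff_of_subset ?_ |>.2 ⟨t, ?_, ?_⟩)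
      · intro s hs
        simp only [Finset.mem_filter] at hs ⊢
        exact ⟨hs.1, hs.2.trans_le hxy⟩
      · simpa [hZ, hty] using htz
      · simp [ht.1]
    omega
  choose! p hp hpe using fun ω (hω : ω ∈ nodalDomains f) => hω
  have hinj : InjOn (fun ω => c (p ω)) (nodalDomains f) := by
    intro ω hω ω' hω' he
    rw [hpe ω hω, hpe ω' hω']
    rcases le_total (p ω) (p ω') with h | h
    · exact key _ (hp ω hω) _ (hp ω' hω') h he
    · exact (key _ (hp ω' hω') _ (hp ω hω) h he.symm).symm
  calc (nodalDomains f).encard ≤ (Finset.range (m + 1) : Set ℕ).encard :=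
        encard_le_encard_of_injOn (fun ω _ => by
          have : c (p ω) ≤ Z.card := Finset.card_filter_le _ _
          simp only [Finset.coe_range, mem_Iio]
          omega) hinj
    _ = _ := by rw [encard_coe_eq_coe_finsetCard, Finset.card_range]

/-! ### Slater determinants and the main theorem -/

/-- The Slater determinant is a linear combination of the functions in its last variable. -/
lemma exists_slater_snoc_eq_linComb (h : ℕ → ℝ → ℝ) {m : ℕ} (c : Fin m → ℝ) :
    ∃ a : Fin (m + 1) → ℝ, ∀ x, slater h (Fin.snoc c x : Fin (m + 1) → ℝ) = linComb h a x := by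
  refine ⟨fun i => (-1) ^ (i + Fin.last m : ℕ) *
    Matrix.det (Matrix.of fun k l : Fin m => h (i.succAbove k) (c l)), fun x => ?_⟩
  rw [slater, Matrix.det_succ_column _ (Fin.last m), linComb]
  refine Finset.sum_congr rfl fun i _ => ?_
  have : (Matrix.of fun i j : Fin (m + 1) => h i ((Fin.snoc c x : Fin (m + 1) → ℝ) j)).submatrix
      i.succAbove (Fin.last m).succAbove =
      Matrix.of fun k l : Fin m => h (i.succAbove k) (c l) := by
    ext k l
    simp
  rw [this]
  simp
  ring

/-- If no nontrivial combination of the first `n` functions has `n` zeros in `]0,1[`, the Slater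
determinant does not vanish at pairwise distinct points. -/
lemma slater_ne_zero {h : ℕ → ℝ → ℝ} {m : ℕ}
    (hcount : ∀ b : Fin (m + 1) → ℝ, b ≠ 0 → (zeroSet (linComb h b)).encard ≤ m)
    {x : Fin (m + 1) → ℝ} (hx : Function.Injective x) (hxI : ∀ i, x i ∈ Ioo (0 : ℝ) 1) :
    slater h x ≠ 0 := by
  intro hdet
  -- A left kernel vector b means that S_b vanishes at every x_i.
  obtain ⟨b, hb, hbv⟩ := Matrix.exists_vecMul_eq_zero_iff.2 hdet
  have hsub : range x ⊆ zeroSet (linComb h b) := by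
    rintro _ ⟨i, rfl⟩
    exact ⟨hxI i, congrFun hbv i⟩
  have h1 := (encard_le_encard hsub).trans (hcount b hb)
  rw [← image_univ, hx.encard_image, encard_univ, ENat.card_eq_coe_fintype_card,
    Fintype.card_fin] at h1
  have h2 : m + 1 ≤ m := by exact_mod_cast h1
  omega

lemma zeroSet_linComb_encard_le {q : ℝ → ℝ} (hq : ContinuousOn q (Icc 0 1))
    {lam : ℕ → ℝ} {h : ℕ → ℝ → ℝ} (hh : IsDirichletEigenpairs q lam h) {m : ℕ}
    {b : Fin (m + 1) → ℝ} (hb : b ≠ 0) : (zeroSet (linComb h b)).encard ≤ m := by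
  -- Only q on [0,1] matters; the extension is continuous and bounded on ℝ, as the Prüfer lemmas
  -- require.
  set Q : ℝ → ℝ := IccExtend (zero_le_one' ℝ) ((Icc (0 : ℝ) 1).domRestrict q) with hQ
  have hQc : Continuous Q := (continuousOn_iff_continuous_domRestrict.1 hq).Icc_extend'
  have hQq : EqOn q Q (Icc 0 1) := fun x hx => by
    rw [hQ, IccExtend_of_mem _ _ hx]; rfl
  obtain ⟨M, hM⟩ := isCompact_Icc.exists_bound_of_continuousOn hq
  have hQM : ∀ x, |Q x| ≤ M := fun x => hM _ (projIcc (0 : ℝ) 1 (zero_le_one' ℝ) x).2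
  replace hh := hh.congr_potential hQq
  choose u v hsys hu hsimple hcount using hh.exists_solvesSystem hQc hQM
  have h0 : ∀ j, u j 0 = 0 := fun j => by
    rw [← hu j (by simp)]; exact (hh.eigenfunction j).left
  have h1 : ∀ j, u j 1 = 0 := fun j => by
    rw [← hu j (by simp)]; exact (hh.eigenfunction j).right
  set b' : ℕ → ℝ := fun j => if hj : j < m + 1 then b ⟨j, hj⟩ else 0 with hb'
  have hlin : ∀ x ∈ Ioo (0 : ℝ) 1,
      linComb h b x = ∑ j ∈ Finset.range (m + 1), b' j * u j x := by
    intro x hx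
    rw [linComb, ← Fin.sum_univ_eq_sum_range (fun j => b' j * u j x)]
    refine Finset.sum_congr rfl fun j _ => ?_
    simp only [hb']
    rw [hu j (Ioo_subset_Icc_self hx), dif_pos j.2]
  -- Liouville's limit needs a nonzero top coefficient, so the sum is cut at the last one; N ≤ m
  -- only sharpens the bound.
  obtain ⟨N, hN, hNb, hNmax⟩ : ∃ N ≤ m, b' N ≠ 0 ∧ ∀ j, N < j → b' j = 0 := by
    obtain ⟨i, hi⟩ := Function.ne_iff.1 hb
    have hS : (Finset.filter (fun j => b' j ≠ 0) (Finset.range (m + 1))).Nonempty :=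
      ⟨i, Finset.mem_filter.2 ⟨Finset.mem_range.2 i.2, by simp only [hb']; rwa [dif_pos i.2]⟩⟩
    have hmax := Finset.max'_mem _ hS
    rw [Finset.mem_filter, Finset.mem_range] at hmax
    refine ⟨_, Nat.lt_succ_iff.1 hmax.1, hmax.2, fun j hj => ?_⟩
    by_contra hne
    refine absurd (Finset.le_max' _ j ?_) (not_le.2 hj)
    refine Finset.mem_filter.2 ⟨Finset.mem_range.2 ?_, hne⟩
    by_contra hjm
    exact hne (by simp only [hb']; rw [dif_neg hjm])
  by_contra! hlt
  have hle : ((N + 1 : ℕ) : ℕ∞) ≤ (zeroSet (linComb h b)).encard := by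
    refine le_trans ?_ (Order.add_one_le_of_lt hlt)
    exact_mod_cast Nat.succ_le_succ hN
  obtain ⟨t, ht, htc⟩ := exists_subset_encard_eq hle
  have htf : t.Finite := finite_of_encard_eq_coe htc
  have htc' : htf.toFinset.card = N + 1 := by
    rw [htf.encard_eq_coe_toFinset_card] at htc
    exact_mod_cast htc
  set z := htf.toFinset.orderEmbOfFin htc' with hz
  have hzt : ∀ i, z i ∈ zeroSet (linComb h b) := fun i =>
    ht (htf.mem_toFinset.1 (Finset.orderEmbOfFin_mem _ htc' i))
  refine not_forall_sum_eq_zero hh.strictMono hsys h0 h1 hsimple hcount N hNb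
    (z := z) ⟨z.strictMono, fun i => (hzt i).1⟩ fun i => ?_
  rw [← (hzt i).2, hlin _ (hzt i).1]
  refine Finset.sum_subset (Finset.range_subset_range.2 (by omega)) fun j _ hj => ?_
  rw [hNmax j (by simpa using hj), zero_mul]

/-- Here `n = m + 1 ≥ 1`, and `Fin.snoc c x` is the point `(c_1, …, c_{n-1}, x)`. -/
theorem mainTheorem2 (q : ℝ → ℝ) (hq : ContinuousOn q (Icc 0 1))
    (lam : ℕ → ℝ) (h : ℕ → ℝ → ℝ) (hh : IsDirichletEigenpairs q lam h) (m : ℕ) :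
    -- the Slater determinant does not vanish in the simplex
    (∀ x ∈ openSimplex (m + 1), slater h x ≠ 0) ∧
    ∀ b : Fin (m + 1) → ℝ, b ≠ 0 →
      -- if `S_b` has (at least) the `n - 1` zeros `c_1 < ⋯ < c_{n-1}`, then `S_b = C 𝔖_n(c, ·)`,
      -- and `S_b` has no other zeros
      (∀ c ∈ openSimplex m, (∀ i, linComb h b (c i) = 0) →
        (∃ C : ℝ, C ≠ 0 ∧ ∀ x ∈ Icc (0 : ℝ) 1,
          linComb h b x = C * slater h (Fin.snoc c x : Fin (m + 1) → ℝ)) ∧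
        zeroSet (linComb h b) = range c) ∧
      -- `S_b` has at most `n - 1` zeros and at most `n` nodal domains
      (zeroSet (linComb h b)).encard ≤ (m : ℕ∞) ∧
      (nodalDomains (linComb h b)).encard ≤ ((m + 1 : ℕ) : ℕ∞) := by
  have hcount : ∀ b : Fin (m + 1) → ℝ, b ≠ 0 → (zeroSet (linComb h b)).encard ≤ m :=
    fun b hb => zeroSet_linComb_encard_le hq hh hb
  refine ⟨fun x hx => slater_ne_zero hcount hx.1.injective hx.2, fun b hb =>
    ⟨fun c hc hc0 => ?_, hcount b hb, encard_nodalDomains_le (hcount b hb)⟩⟩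
  have hrange : ∀ a : Fin (m + 1) → ℝ, a ≠ 0 → (∀ i, linComb h a (c i) = 0) →
      zeroSet (linComb h a) = range c := by
    intro a ha ha0
    refine ((finite_range c).eq_of_subset_of_encard_le ?_ ?_).symm
    · rintro _ ⟨i, rfl⟩
      exact ⟨hc.2 i, ha0 i⟩
    · rw [← image_univ, hc.1.injective.encard_image, encard_univ, ENat.card_eq_coe_fintype_card,
        Fintype.card_fin]
      exact hcount a ha
  refine ⟨?_, hrange b hb hc0⟩
  obtain ⟨x₀, hx₀, hx₀c⟩ : ∃ x ∈ Ioo (0 : ℝ) 1, x ∉ range c :=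
    (Ioo_infinite (zero_lt_one' ℝ)).exists_notMem_finite (finite_range c)
  have hS : slater h (Fin.snoc c x₀ : Fin (m + 1) → ℝ) ≠ 0 := by
    refine slater_ne_zero hcount (Fin.snoc_injective_iff.2 ⟨hc.1.injective, hx₀c⟩) fun i => ?_
    cases i using Fin.lastCases with
    | last => rwa [Fin.snoc_last]
    | cast i => rw [Fin.snoc_castSucc]; exact hc.2 i
  have hb0 : linComb h b x₀ ≠ 0 := fun h0 => hx₀c (hrange b hb hc0 ▸ ⟨hx₀, h0⟩)
  obtain ⟨a, ha⟩ := exists_slater_snoc_eq_linComb h c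
  have hac : ∀ i, linComb h a (c i) = 0 := by
    intro i
    rw [← ha]
    exact Matrix.det_zero_of_column_eq (Fin.castSucc_lt_last i).ne fun k => by simp
  set C := linComb h b x₀ / slater h (Fin.snoc c x₀ : Fin (m + 1) → ℝ) with hC
  have hsub : ∀ x, linComb h (b - C • a) x = linComb h b x - C * linComb h a x := by
    intro x
    simp only [linComb, Finset.mul_sum, ← Finset.sum_sub_distrib]
    exact Finset.sum_congr rfl fun j _ => by simp; ring
  -- By the choice of C, S_b - C S_a vanishes at the m points c_i and at x₀, one zero too many.
  have hzero : b - C • a = 0 := by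
    by_contra hne
    refine hx₀c (hrange _ hne (fun i => by rw [hsub, hc0, hac]; simp) ▸ ⟨hx₀, ?_⟩)
    rw [hsub, ← ha, hC, div_mul_cancel₀ _ hS, sub_self]
  refine ⟨C, div_ne_zero hb0 hS, fun x _ => ?_⟩
  have := hsub x
  rw [hzero] at this
  rw [ha, ← sub_eq_zero, ← this]
  simp [linComb]
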